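/- \textbf{Theorem.} Let $M$ be a compact, connected smooth manifold, possibly with boundary, let $t_0<t_1$ and $L=[t_0,t_1]\times M$. For $j\in\{1,2,\dots\}\cup\{\infty\}$ let $\sigma_j$ be a continuous Riemannian metric on $M$, let $h_j:M\to(0,\infty)$ be a function, with $h_\infty$ continuous, and let $g_j=-h_j^2\,dt^2+\sigma_j$ on $L$, time-oriented so that $t$ increases to the future. A nonzero tangent vector $v$ is causal for $g_j$ if $g_j(v,v)\le 0$. For $p,q\in L$ the null distance of $g_j$ with respect to the time function $t$ is $$\hat d_{t,g_j}(p,q)=\inf_\beta \sum_{i=1}^k \bigl|t(\beta(s_i))-t(\beta(s_{i-1}))\bigr|\in[0,\infty],$$ where $\beta$ runs over the piecewise causal curves in $L$ from $p$ to $q$, that is, the continuous curves with a partition $s_0<s_1<\dots<s_k$ of the parameter interval such that on each piece $[s_{i-1},s_i]$ the curve $\beta$ is smooth and is either future-directed causal or past-directed causal for $g_j$; the infimum over the empty set is $\infty$. Suppose that for every $j\in\{1,2,\dots\}$ $$\frac{\sigma_j(x)(v,v)}{h_j(x)^2}\ \ge\ \Bigl(1-\frac1j\Bigr)\frac{\sigma_\infty(x)(v,v)}{h_\infty(x)^2}\qquad\text{for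 all } x\in M,\ v\in T_xM.$$ Then there are constants $C(j)\ge 0$ with $C(j)\to 0$ as $j\to\infty$ such that $$\hat d_{t,g_j}(p,q)\ \ge\ \hat d_{t,g_\infty}(p,q)-C(j)\qquad\text{for all } j\in\{1,2,\dots\},\ p,q\in L.$$ -/

import Mathlib

open Set Filter Topology Bundle
open scoped Manifold ContDiff ENNReal

noncomputable section

namespace StaticSpacetime

variable {E : Type*} [NormedAddCommGroup E] [NormedSpace ℝ E]
  {H : Type*} [TopologicalSpace H] (I : ModelWithCorners ℝ E H)
  {M : Type*} [TopologicalSpace M] [ChartedSpace H M]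

/-- A field of (real valued) two-argument forms on the tangent spaces of `ℝ × M`; the tangent space
at `p` is `ℝ × T_{p.2} M`, its first component being the `t`-direction. -/
abbrev FormField (M : Type*) [TopologicalSpace M] [ChartedSpace H M] : Type _ :=
  ∀ p : ℝ × M, (ℝ × TangentSpace I p.2) → (ℝ × TangentSpace I p.2) → ℝ

/-- The region `L = [t₀, t₁] × M` of `ℝ × M`. -/
def slab (M : Type*) (t₀ t₁ : ℝ) : Set (ℝ × M) := Icc t₀ t₁ ×ˢ univ

/-- The velocity of `β : ℝ → ℝ × M` at `s`, computed within the parameter set `S`. -/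
def velocity (β : ℝ → ℝ × M) (S : Set ℝ) (s : ℝ) : ℝ × TangentSpace I (β s).2 :=
  (derivWithin (fun r => (β r).1) S s,
    mfderivWithin 𝓘(ℝ, ℝ) I (fun r => (β r).2) S s 1)

variable {I}

/-- `v` is causal for `g` and future-directed, for the time orientation in which `t` increases
(so `v ≠ 0`). -/
def IsFutureCausal (g : FormField I M) (p : ℝ × M) (v : ℝ × TangentSpace I p.2) : Prop :=
  g p v v ≤ 0 ∧ 0 < v.1

/-- `v` is causal for `g` and past-directed. -/
def IsPastCausal (g : FormField I M) (p : ℝ × M) (v : ℝ × TangentSpace I p.2) : Prop :=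
  g p v v ≤ 0 ∧ v.1 < 0

/-- Piecewise causal curves in the region `L` from `p` to `q`: there is a partition
`s 0 < s 1 < ⋯ < s k` of the parameter interval such that on each closed piece the curve
is smooth and is either future-directed causal or past-directed causal.
(For `k = 0` this is the constant curve at `p = q`.) -/
structure PiecewiseCausalCurve (g : FormField I M) (L : Set (ℝ × M)) (p q : ℝ × M) where
  /-- the curve, of which only the restriction to `[s 0, s k]` matters -/
  toFun : ℝ → ℝ × M
  /-- the number of pieces -/
  k : ℕ
  /-- the partition points -/
  s : Fin (k + 1) → ℝ
  strictMono : StrictMono s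
  source : toFun (s 0) = p
  target : toFun (s (Fin.last k)) = q
  mem : ∀ r ∈ Icc (s 0) (s (Fin.last k)), toFun r ∈ L
  smooth_fst : ∀ i : Fin k,
    ContDiffOn ℝ ∞ (fun r => (toFun r).1) (Icc (s i.castSucc) (s i.succ))
  smooth_snd : ∀ i : Fin k,
    ContMDiffOn 𝓘(ℝ, ℝ) I ∞ (fun r => (toFun r).2) (Icc (s i.castSucc) (s i.succ))
  causal : ∀ i : Fin k,
    (∀ r ∈ Icc (s i.castSucc) (s i.succ),
      IsFutureCausal g (toFun r) (velocity I toFun (Icc (s i.castSucc) (s i.succ)) r)) ∨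
    (∀ r ∈ Icc (s i.castSucc) (s i.succ),
      IsPastCausal g (toFun r) (velocity I toFun (Icc (s i.castSucc) (s i.succ)) r))

/-- The null length of a piecewise causal curve with respect to the time function `τ`. -/
def PiecewiseCausalCurve.nullLength {g : FormField I M} {L : Set (ℝ × M)} {p q : ℝ × M}
    (β : PiecewiseCausalCurve g L p q) (τ : ℝ × M → ℝ) : ℝ :=
  ∑ i : Fin β.k, |τ (β.toFun (β.s i.succ)) - τ (β.toFun (β.s i.castSucc))|

/-- The null distance of the spacetime `(L, g)` with respect to the time function `τ`: the infimum
of the null lengths of the piecewise causal curves in `L` from `p` to `q` (it is `∞` if there are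
none). -/
def nullDist (τ : ℝ × M → ℝ) (g : FormField I M) (L : Set (ℝ × M)) (p q : ℝ × M) : ℝ≥0∞ :=
  ⨅ β : PiecewiseCausalCurve g L p q, ENNReal.ofReal (β.nullLength τ)

/-- The coordinate time function `t`. -/
def coordTime (p : ℝ × M) : ℝ := p.1

/-- The static metric `g = -h² dt² + σ` on `ℝ × M`. -/
def staticMetric [IsManifold I 1 M]
    (h : M → ℝ) (σ : ContinuousRiemannianMetric E (fun x : M => TangentSpace I x)) :
    FormField I M :=
  fun p v w => -(h p.2) ^ 2 * (v.1 * w.1) + σ.inner p.2 v.2 w.2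

end StaticSpacetime

end

/-! Put `m = √(1 - 1/j)` and `l = 1/m`. If `(t(r), x(r))` is causal for `g_j`, the hypothesis makes
a curve over the same `x(r)` causal for `g_∞` once its time coordinate runs `l` times as fast.
Simply rescaling time would leave `[t₀, t₁]`, and the endpoint would be wrong. Instead, on each
causal piece the faster time is folded back into the interval between the two end times, as a zigzag
with the same endpoints (`nullDist_coordTime_le_add`). The zigzag has null length `l` times the
original, so `m * d_∞ ≤ d_j` for `j ≥ 2`.

Hence `d_∞ - d_j ≤ (1 - m) * d_∞`, which tends to zero uniformly once `d_∞` has a finite bound `D`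
on the slab. That bound (`exists_nullDist_le`) comes from compactness and connectedness of `M`:
nearby points of `M` can be joined at a cost of at most `3 * (t₁ - t₀)`, whatever their time
coordinates. So `C(j) = (1 - m) * D`. -/

namespace StaticSpacetime

/-! ### Causal pieces: translation, concatenation, and adding one piece to the null distance. -/

section Piece

variable {E : Type*} [NormedAddCommGroup E] [NormedSpace ℝ E]
  {H : Type*} [TopologicalSpace H] {I : ModelWithCorners ℝ E H}
  {M : Type*} [TopologicalSpace M] [ChartedSpace H M]

/-- The restriction of `γ` to `[a, b]` is a smooth future- or past-directed causal curve in `L`. -/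
structure IsCausalPiece (g : FormField I M) (L : Set (ℝ × M)) (γ : ℝ → ℝ × M) (a b : ℝ) :
    Prop where
  lt : a < b
  mem : ∀ r ∈ Icc a b, γ r ∈ L
  smooth_fst : ContDiffOn ℝ ∞ (fun r => (γ r).1) (Icc a b)
  smooth_snd : ContMDiffOn 𝓘(ℝ, ℝ) I ∞ (fun r => (γ r).2) (Icc a b)
  causal : (∀ r ∈ Icc a b, IsFutureCausal g (γ r) (velocity I γ (Icc a b) r)) ∨
    (∀ r ∈ Icc a b, IsPastCausal g (γ r) (velocity I γ (Icc a b) r))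

lemma uniqueMDiffWithinAt_Icc {a b r : ℝ} (hab : a < b) (hr : r ∈ Icc a b) :
    UniqueMDiffWithinAt 𝓘(ℝ, ℝ) (Icc a b) r :=
  (uniqueDiffOn_Icc hab r hr).uniqueMDiffWithinAt

/-- Two-argument forms and causality only depend on base point and vector. -/
lemma isFutureCausal_congr {g : FormField I M} {p q : ℝ × M} (hpq : p = q)
    {v : ℝ × TangentSpace I p.2} {w : ℝ × TangentSpace I q.2}
    (h₁ : v.1 = w.1) (h₂ : (v.2 : E) = (w.2 : E)) (h : IsFutureCausal g p v) :
    IsFutureCausal g q w := by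
  subst hpq
  have : v = w := Prod.ext h₁ h₂
  rwa [← this]

lemma isPastCausal_congr {g : FormField I M} {p q : ℝ × M} (hpq : p = q)
    {v : ℝ × TangentSpace I p.2} {w : ℝ × TangentSpace I q.2}
    (h₁ : v.1 = w.1) (h₂ : (v.2 : E) = (w.2 : E)) (h : IsPastCausal g p v) :
    IsPastCausal g q w := by
  subst hpq
  have : v = w := Prod.ext h₁ h₂
  rwa [← this]

lemma mfderivWithin_apply_congr {f f' : ℝ → M} {S : Set ℝ} (h : EqOn f f' S) {r : ℝ}
    (hr : r ∈ S) :
    (mfderivWithin 𝓘(ℝ, ℝ) I f S r 1 : E) = (mfderivWithin 𝓘(ℝ, ℝ) I f' S r 1 : E) := by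
  have := mfderivWithin_congr_of_mem (I := 𝓘(ℝ, ℝ)) (I' := I) h hr
  exact congrArg (fun (A : ℝ →L[ℝ] E) => A 1) this

lemma IsCausalPiece.congr {g : FormField I M} {L : Set (ℝ × M)} {γ γ' : ℝ → ℝ × M} {a b : ℝ}
    (h : IsCausalPiece g L γ a b) (he : EqOn γ γ' (Icc a b)) : IsCausalPiece g L γ' a b where
  lt := h.lt
  mem r hr := he hr ▸ h.mem r hr
  smooth_fst := h.smooth_fst.congr fun r hr => by simp only [he hr]
  smooth_snd := h.smooth_snd.congr fun r hr => by simp only [he hr]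
  causal := by
    have h₁ : ∀ r ∈ Icc a b, (velocity I γ (Icc a b) r).1 = (velocity I γ' (Icc a b) r).1 :=
      fun r hr => derivWithin_congr (fun s hs => by simp only [he hs]) (by simp only [he hr])
    have h₂ : ∀ r ∈ Icc a b,
        ((velocity I γ (Icc a b) r).2 : E) = ((velocity I γ' (Icc a b) r).2 : E) :=
      fun r hr => mfderivWithin_apply_congr (fun s hs => by simp only [he hs]) hr
    exact h.causal.imp
      (fun H r hr => isFutureCausal_congr (he hr) (h₁ r hr) (h₂ r hr) (H r hr))
      (fun H r hr => isPastCausal_congr (he hr) (h₁ r hr) (h₂ r hr) (H r hr))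

lemma IsCausalPiece.comp_add_const {g : FormField I M} {L : Set (ℝ × M)} {γ : ℝ → ℝ × M}
    {a b : ℝ} (h : IsCausalPiece g L γ a b) (c : ℝ) :
    IsCausalPiece g L (fun r => γ (r + c)) (a - c) (b - c) := by
  have hm : MapsTo (fun r : ℝ => r + c) (Icc (a - c) (b - c)) (Icc a b) := fun r hr =>
    ⟨by linarith [hr.1], by linarith [hr.2]⟩
  have hsm : ContDiff ℝ ∞ (fun r : ℝ => r + c) := by fun_prop
  have hlt : a - c < b - c := by linarith [h.lt]
  have h₁ : ∀ r ∈ Icc (a - c) (b - c),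
      derivWithin (fun r => (γ (r + c)).1) (Icc (a - c) (b - c)) r =
        derivWithin (fun r => (γ r).1) (Icc a b) (r + c) := fun r hr => by
    have h₃ : HasDerivWithinAt (fun r => (γ r).1)
        (derivWithin (fun r => (γ r).1) (Icc a b) (r + c)) (Icc a b) (r + c) :=
      ((h.smooth_fst.differentiableOn (by simp)) _ (hm hr)).hasDerivWithinAt
    have h₄ := h₃.comp r ((hasDerivAt_id r).add_const c).hasDerivWithinAt hm
    exact (h₄.derivWithin (uniqueDiffOn_Icc hlt r hr)).trans (mul_one _)
  have h₂ : ∀ r ∈ Icc (a - c) (b - c),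
      (mfderivWithin 𝓘(ℝ, ℝ) I (fun r => (γ (r + c)).2) (Icc (a - c) (b - c)) r 1 : E) =
        (mfderivWithin 𝓘(ℝ, ℝ) I (fun r => (γ r).2) (Icc a b) (r + c) 1 : E) := fun r hr => by
    have h₃ := (h.smooth_snd.mdifferentiableOn (by simp)) _ (hm hr)
    have h₄ : HasMFDerivWithinAt 𝓘(ℝ, ℝ) 𝓘(ℝ, ℝ) (fun r : ℝ => r + c) (Icc (a - c) (b - c)) r
        (ContinuousLinearMap.id ℝ ℝ) :=
      ((hasFDerivAt_id r).add_const c).hasMFDerivAt.hasMFDerivWithinAt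
    have h₅ := (HasMFDerivWithinAt.comp r h₃.hasMFDerivWithinAt h₄ hm.subset_preimage).mfderivWithin
      (uniqueMDiffWithinAt_Icc hlt hr)
    exact congrArg (fun (A : ℝ →L[ℝ] E) => A 1) h₅
  refine ⟨hlt, fun r hr => h.mem _ (hm hr), h.smooth_fst.comp hsm.contDiffOn hm,
    h.smooth_snd.comp hsm.contMDiff.contMDiffOn hm, ?_⟩
  exact h.causal.imp
      (fun H r hr => isFutureCausal_congr rfl (h₁ r hr).symm (h₂ r hr).symm (H _ (hm hr)))
      (fun H r hr => isPastCausal_congr rfl (h₁ r hr).symm (h₂ r hr).symm (H _ (hm hr)))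

/-- The pieces of a piecewise causal curve are causal pieces. -/
lemma PiecewiseCausalCurve.isCausalPiece {g : FormField I M} {L : Set (ℝ × M)} {p q : ℝ × M}
    (β : PiecewiseCausalCurve g L p q) (i : Fin β.k) :
    IsCausalPiece g L β.toFun (β.s i.castSucc) (β.s i.succ) where
  lt := β.strictMono i.castSucc_lt_succ
  mem r hr := β.mem r ⟨(β.strictMono.monotone (Fin.zero_le _)).trans hr.1,
    hr.2.trans (β.strictMono.monotone (Fin.le_last _))⟩
  smooth_fst := β.smooth_fst i
  smooth_snd := β.smooth_snd i
  causal := β.causal i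

/-- Extension of a piecewise causal curve by a causal piece. -/
lemma PiecewiseCausalCurve.exists_extend {g : FormField I M} {L : Set (ℝ × M)} {p : ℝ × M}
    {γ : ℝ → ℝ × M} {a b : ℝ} (h : IsCausalPiece g L γ a b)
    (β : PiecewiseCausalCurve g L p (γ a)) (τ : ℝ × M → ℝ) :
    ∃ β' : PiecewiseCausalCurve g L p (γ b),
      β'.nullLength τ = β.nullLength τ + |τ (γ b) - τ (γ a)| := by
  set e := β.s (Fin.last β.k) with he
  -- The new piece is translated so that its parameter starts at `e`, where `β` ends. Both branches
  -- take the value `γ a` there, and velocities are one-sided on closed pieces, so no smooth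
  -- matching is needed at the joint.
  set f : ℝ → ℝ × M := fun r => if r ≤ e then β.toFun r else γ (r + (a - e)) with hf
  have hab := h.lt
  have hγ : IsCausalPiece g L (fun r => γ (r + (a - e))) e (e + (b - a)) := by
    have := h.comp_add_const (a - e)
    convert this using 1 <;> ring
  have hf₁ : ∀ r ≤ e, β.toFun r = f r := fun r hr => by simp [hf, hr]
  have hf₂ : ∀ r, e ≤ r → γ (r + (a - e)) = f r := fun r hr => by
    rcases hr.eq_or_lt with rfl | hr
    · rw [← hf₁ _ le_rfl, he, β.target]; congr 1; ring
    · simp [hf, not_le.2 hr]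
  have hfs : f (e + (b - a)) = γ b := by
    rw [← hf₂ _ (by linarith)]; congr 1; ring
  have hle : ∀ i, β.s i ≤ e := fun i => β.strictMono.monotone (Fin.le_last i)
  set s : Fin (β.k + 1 + 1) → ℝ := Fin.snoc (α := fun _ => ℝ) β.s (e + (b - a)) with hs
  have hs₁ : ∀ i : Fin (β.k + 1), s i.castSucc = β.s i := fun i => by simp [hs]
  have hs₂ : s (Fin.last _) = e + (b - a) := by simp [hs]
  have hs₀ : s 0 = β.s 0 := hs₁ 0
  have key : ∀ i : Fin (β.k + 1), IsCausalPiece g L f (s i.castSucc) (s i.succ) := by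
    intro i
    induction i using Fin.lastCases with
    | last =>
      rw [Fin.succ_last, hs₁, hs₂]
      exact hγ.congr fun r hr => hf₂ r hr.1
    | cast i =>
      rw [hs₁, Fin.succ_castSucc, hs₁]
      exact (β.isCausalPiece i).congr fun r hr => hf₁ r (hr.2.trans (hle _))
  refine ⟨⟨f, β.k + 1, s, Fin.strictMono_iff_lt_succ.2 fun i => (key i).lt, ?_, ?_, ?_,
    fun i => (key i).smooth_fst, fun i => (key i).smooth_snd, fun i => (key i).causal⟩, ?_⟩
  · rw [hs₀, ← hf₁ _ (hle _), β.source]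
  · rw [hs₂, hfs]
  · rw [hs₀, hs₂]
    intro r hr
    rcases le_total r e with hre | hre
    · rw [← hf₁ r hre]; exact β.mem r ⟨hr.1, hre⟩
    · rw [← hf₂ r hre]; exact hγ.mem r ⟨hre, hr.2⟩
  · simp only [nullLength]
    rw [Fin.sum_univ_castSucc]
    congr 1
    · refine Finset.sum_congr rfl fun i _ => ?_
      rw [hs₁, Fin.succ_castSucc, hs₁, ← hf₁ _ (hle _), ← hf₁ _ (hle _)]
    · rw [Fin.succ_last, hs₁, hs₂, hfs, ← he, ← hf₁ _ le_rfl, he, β.target]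

/-- This replaces the triangle inequality throughout: curves are always lengthened at their far end,
with the starting point `p` fixed. -/
lemma nullDist_le_add_of_isCausalPiece {g : FormField I M} {L : Set (ℝ × M)} {γ : ℝ → ℝ × M}
    {a b : ℝ} (h : IsCausalPiece g L γ a b) (τ : ℝ × M → ℝ) (p : ℝ × M) :
    nullDist τ g L p (γ b) ≤
      nullDist τ g L p (γ a) + ENNReal.ofReal |τ (γ b) - τ (γ a)| := by
  simp only [nullDist]
  rw [ENNReal.iInf_add]
  refine le_iInf fun β => ?_
  obtain ⟨β', hβ'⟩ := β.exists_extend h τ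
  refine (iInf_le _ β').trans ?_
  rw [hβ']
  exact ENNReal.ofReal_add_le

lemma nullDist_self {g : FormField I M} {L : Set (ℝ × M)} (τ : ℝ × M → ℝ) {p : ℝ × M}
    (hp : p ∈ L) : nullDist τ g L p p = 0 := by
  let β : PiecewiseCausalCurve g L p p :=
    { toFun := fun _ => p
      k := 0
      s := fun _ => 0
      strictMono := Subsingleton.strictMono (α := Fin 1) _
      source := rfl
      target := rfl
      mem := fun _ _ => hp
      smooth_fst := fun i => i.elim0
      smooth_snd := fun i => i.elim0
      causal := fun i => i.elim0 }
  refine le_antisymm ((iInf_le _ β).trans ?_) bot_le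
  simp [PiecewiseCausalCurve.nullLength, β]

end Piece

/-! ### Comparison of null distances by folding accelerated time. -/

section Comparison

variable {E : Type*} [NormedAddCommGroup E] [NormedSpace ℝ E]
  {H : Type*} [TopologicalSpace H] {I : ModelWithCorners ℝ E H}
  {M : Type*} [TopologicalSpace M] [ChartedSpace H M]

/-- Along a causal piece the time coordinate is strictly monotone. -/
lemma IsCausalPiece.strictMonoOn_or_strictAntiOn {g : FormField I M} {L : Set (ℝ × M)}
    {γ : ℝ → ℝ × M} {a b : ℝ} (hγ : IsCausalPiece g L γ a b) :
    StrictMonoOn (fun r => (γ r).1) (Icc a b) ∨ StrictAntiOn (fun r => (γ r).1) (Icc a b) := by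
  have hd : ∀ r ∈ interior (Icc a b),
      derivWithin (fun r => (γ r).1) (Icc a b) r = deriv (fun r => (γ r).1) r := fun r hr =>
    derivWithin_of_mem_nhds (mem_interior_iff_mem_nhds.1 hr)
  refine hγ.causal.imp (fun H => ?_) (fun H => ?_)
  · refine strictMonoOn_of_deriv_pos (convex_Icc a b) hγ.smooth_fst.continuousOn fun r hr => ?_
    rw [← hd r hr]
    exact (H r (interior_subset hr)).2
  · refine strictAntiOn_of_deriv_neg (convex_Icc a b) hγ.smooth_fst.continuousOn fun r hr => ?_
    rw [← hd r hr]
    exact (H r (interior_subset hr)).2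

variable [IsManifold I 1 M]
  {h h' : M → ℝ} {σ σ' : ContinuousRiemannianMetric E (fun x : M => TangentSpace I x)}
  {l t₀ t₁ : ℝ}

/-- Replacing the time coordinate of a causal piece by an affine function of it. -/
lemma IsCausalPiece.affine_time (hpos : ∀ x, 0 < h x) (hpos' : ∀ x, 0 < h' x) (hl : 0 < l)
    (hσ : ∀ (x : M) (v : TangentSpace I x),
      σ'.inner x v v / h' x ^ 2 ≤ l ^ 2 * (σ.inner x v v / h x ^ 2))
    {γ : ℝ → ℝ × M} {a b : ℝ} (hγ : IsCausalPiece (staticMetric h σ) (slab M t₀ t₁) γ a b)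
    {a' b' A B : ℝ} (hab : a' < b') (hsub : Icc a' b' ⊆ Icc a b) (hB : B = l ∨ B = -l)
    (hmem : ∀ r ∈ Icc a' b', A + B * (γ r).1 ∈ Icc t₀ t₁) :
    IsCausalPiece (staticMetric h' σ') (slab M t₀ t₁)
      (fun r => (A + B * (γ r).1, (γ r).2)) a' b' := by
  have h₁ : ∀ r ∈ Icc a' b',
      derivWithin (fun r => A + B * (γ r).1) (Icc a' b') r =
        B * derivWithin (fun r => (γ r).1) (Icc a b) r := fun r hr => by
    have h₃ : HasDerivWithinAt (fun r => (γ r).1)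
        (derivWithin (fun r => (γ r).1) (Icc a b) r) (Icc a b) r :=
      ((hγ.smooth_fst.differentiableOn (by simp)) _ (hsub hr)).hasDerivWithinAt
    exact (((h₃.mono hsub).const_mul B).const_add A).derivWithin (uniqueDiffOn_Icc hab r hr)
  have h₂ : ∀ r ∈ Icc a' b',
      mfderivWithin 𝓘(ℝ, ℝ) I (fun r => (γ r).2) (Icc a' b') r =
        mfderivWithin 𝓘(ℝ, ℝ) I (fun r => (γ r).2) (Icc a b) r := fun r hr =>
    ((hγ.smooth_snd.mdifferentiableOn (by simp)) _ (hsub hr)).mfderivWithin_mono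
      (uniqueMDiffWithinAt_Icc hab hr) hsub
  -- The form sees only `B ^ 2`, so running time backwards at speed `l` is as causal as running it
  -- forwards.
  have hB2 : B ^ 2 = l ^ 2 := by rcases hB with rfl | rfl <;> ring
  have h₃ : ∀ (x : M) (t : ℝ) (v : TangentSpace I x), -(h x) ^ 2 * (t * t) + σ.inner x v v ≤ 0 →
      -(h' x) ^ 2 * (B * t * (B * t)) + σ'.inner x v v ≤ 0 := by
    intro x t v hv
    have hx := sq_pos_of_pos (hpos x)
    have hx' := sq_pos_of_pos (hpos' x)
    have h₄ : σ.inner x v v / h x ^ 2 ≤ t * t := by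
      rw [div_le_iff₀ hx]; linarith
    have h₅ := (hσ x v).trans (mul_le_mul_of_nonneg_left h₄ (sq_nonneg l))
    rw [div_le_iff₀ hx'] at h₅
    rw [← hB2] at h₅
    linarith
  have h₆ : ∀ r ∈ Icc a' b', staticMetric h σ (γ r) (velocity I γ (Icc a b) r)
      (velocity I γ (Icc a b) r) ≤ 0 →
      staticMetric h' σ' (A + B * (γ r).1, (γ r).2)
        (velocity I (fun r => (A + B * (γ r).1, (γ r).2)) (Icc a' b') r)
        (velocity I (fun r => (A + B * (γ r).1, (γ r).2)) (Icc a' b') r) ≤ 0 := by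
    intro r hr H
    have := h₃ _ _ _ H
    simp only [staticMetric, velocity]
    rw [h₁ r hr, h₂ r hr]
    exact this
  refine ⟨hab, fun r hr => ⟨hmem r hr, mem_univ _⟩,
    contDiffOn_const.add (contDiffOn_const.mul (hγ.smooth_fst.mono hsub)),
    hγ.smooth_snd.mono hsub, ?_⟩
  simp only [IsFutureCausal, IsPastCausal]
  rcases hB with rfl | rfl
  · refine hγ.causal.imp (fun H r hr => ⟨h₆ r hr (H r (hsub hr)).1, ?_⟩)
      (fun H r hr => ⟨h₆ r hr (H r (hsub hr)).1, ?_⟩)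
    · exact (mul_pos hl (H r (hsub hr)).2).trans_eq (h₁ r hr).symm
    · exact (h₁ r hr).trans_lt (mul_neg_of_pos_of_neg hl (H r (hsub hr)).2)
  -- For `B = -l` the future and past alternatives are exchanged.
  · refine hγ.causal.symm.imp (fun H r hr => ⟨h₆ r hr (H r (hsub hr)).1, ?_⟩)
      (fun H r hr => ⟨h₆ r hr (H r (hsub hr)).1, ?_⟩)
    · exact (mul_pos_of_neg_of_neg (neg_neg_of_pos hl) (H r (hsub hr)).2).trans_eq (h₁ r hr).symm
    · exact (h₁ r hr).trans_lt (mul_neg_of_neg_of_pos (neg_neg_of_pos hl) (H r (hsub hr)).2)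

/-- The accelerated time runs from the initial to the final time of the piece, turns back, and turns
again so as to end at the final time. It never leaves the interval between them, hence stays in the
slab; its total variation is `l` times the original time difference. -/
lemma nullDist_coordTime_le_add (hpos : ∀ x, 0 < h x) (hpos' : ∀ x, 0 < h' x)
    (hl₁ : 1 < l) (hl₃ : l ≤ 3)
    (hσ : ∀ (x : M) (v : TangentSpace I x),
      σ'.inner x v v / h' x ^ 2 ≤ l ^ 2 * (σ.inner x v v / h x ^ 2))
    {γ : ℝ → ℝ × M} {a b : ℝ} (hγ : IsCausalPiece (staticMetric h σ) (slab M t₀ t₁) γ a b)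
    (p : ℝ × M) :
    nullDist coordTime (staticMetric h' σ') (slab M t₀ t₁) p (γ b) ≤
      nullDist coordTime (staticMetric h' σ') (slab M t₀ t₁) p (γ a) +
        ENNReal.ofReal (l * |coordTime (γ b) - coordTime (γ a)|) := by
  have hl : 0 < l := by linarith
  have hab := hγ.lt
  have ha : a ∈ Icc a b := left_mem_Icc.2 hab.le
  have hb : b ∈ Icc a b := right_mem_Icc.2 hab.le
  obtain ⟨u, hu⟩ : ∃ u, u = (γ a).1 := ⟨_, rfl⟩
  obtain ⟨v, hv⟩ : ∃ v, v = (γ b).1 := ⟨_, rfl⟩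
  have hut : u ∈ Icc t₀ t₁ := hu ▸ (hγ.mem a ha).1
  have hvt : v ∈ Icc t₀ t₁ := hv ▸ (hγ.mem b hb).1
  have huv : v - u ≠ 0 := by
    rw [hu, hv]
    rcases hγ.strictMonoOn_or_strictAntiOn with H | H
    · exact (sub_pos.2 (H ha hb hab)).ne'
    · exact (sub_neg.2 (H ha hb hab)).ne
  -- the normalized time coordinate increases from `0` to `1`
  obtain ⟨F, hF⟩ : ∃ F : ℝ → ℝ, ∀ r, F r = ((γ r).1 - u) / (v - u) := ⟨_, fun _ => rfl⟩
  have hFt : ∀ r, (γ r).1 = u + (v - u) * F r := fun r => by rw [hF]; field_simp; ring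
  have hFa : F a = 0 := by rw [hF, ← hu]; simp
  have hFb : F b = 1 := by rw [hF, ← hv, div_self huv]
  have hFm : StrictMonoOn F (Icc a b) := by
    intro r hr s hs hrs
    rw [hF, hF]
    rcases hγ.strictMonoOn_or_strictAntiOn with H | H
    · have : 0 < v - u := by rw [hu, hv]; exact sub_pos.2 (H ha hb hab)
      exact div_lt_div_of_pos_right (sub_lt_sub_right (H hr hs hrs) _) this
    · have : v - u < 0 := by rw [hu, hv]; exact sub_neg.2 (H ha hb hab)
      exact div_lt_div_of_neg_of_lt this (sub_lt_sub_right (H hr hs hrs) _)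
  have hFc : ContinuousOn F (Icc a b) := by
    have : F = fun r => ((γ r).1 - u) / (v - u) := funext hF
    rw [this]
    exact (hγ.smooth_fst.continuousOn.sub continuousOn_const).div_const _
  have hivt := intermediate_value_Icc hab.le hFc
  rw [hFa, hFb] at hivt
  have hli : l * (1 / l) = 1 := by field_simp
  have hl1 : 1 / l < 1 := by rw [div_lt_one hl]; exact hl₁
  have hl0 : 0 < 1 / l := by positivity
  -- The turning points: `l * F` reaches `1` when `F = 1 / l`, and the remaining range of `F` is
  -- halved, so that the way back and the way forth, each of normalized length `(l - 1) / 2`,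
  -- cancel.
  obtain ⟨s₁, hs₁, hFs₁⟩ := hivt (show 1 / l ∈ Icc (0 : ℝ) 1 from ⟨by linarith, by linarith⟩)
  obtain ⟨s₂, hs₂, hFs₂⟩ := hivt (show (1 + 1 / l) / 2 ∈ Icc (0 : ℝ) 1 from
    ⟨by linarith, by linarith⟩)
  have has₁ : a < s₁ := (hFm.lt_iff_lt ha hs₁).1 (by rw [hFa, hFs₁]; exact hl0)
  have hs₁₂ : s₁ < s₂ := (hFm.lt_iff_lt hs₁ hs₂).1 (by rw [hFs₁, hFs₂]; linarith)
  have hs₂b : s₂ < b := (hFm.lt_iff_lt hs₂ hb).1 (by rw [hFs₂, hFb]; linarith)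
  have hconv : ∀ c ∈ Icc (0 : ℝ) 1, u + (v - u) * c ∈ Icc t₀ t₁ := fun c hc => by
    have := (convex_Icc t₀ t₁) hut hvt (sub_nonneg.2 hc.2) hc.1 (by ring)
    simp only [smul_eq_mul] at this
    convert this using 1; ring
  -- In normalized time the three legs are `l * F`, `2 - l * F` and `1 - l + l * F`. They agree at
  -- the turning points, and the last one equals `1` at `F = 1`.
  have e₁ : ∀ r, u - l * u + l * (γ r).1 = u + (v - u) * (l * F r) := fun r => by
    rw [hFt]; ring
  have e₂ : ∀ r, u + 2 * (v - u) + l * u + -l * (γ r).1 = u + (v - u) * (2 - l * F r) :=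
    fun r => by rw [hFt]; ring
  have e₃ : ∀ r, u + (1 - l) * (v - u) - l * u + l * (γ r).1 =
      u + (v - u) * (1 - l + l * F r) := fun r => by rw [hFt]; ring
  have P₁ : IsCausalPiece (staticMetric h' σ') (slab M t₀ t₁)
      (fun r => (u - l * u + l * (γ r).1, (γ r).2)) a s₁ := by
    refine hγ.affine_time hpos hpos' hl hσ has₁ (Icc_subset_Icc le_rfl hs₁.2) (Or.inl rfl) ?_
    intro r hr
    have hr' : r ∈ Icc a b := ⟨hr.1, hr.2.trans hs₁.2⟩
    have h₁ := hFm.monotoneOn ha hr' hr.1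
    have h₂ := hFm.monotoneOn hr' hs₁ hr.2
    rw [hFa] at h₁
    rw [hFs₁] at h₂
    rw [e₁]
    exact hconv _ ⟨by positivity, hli ▸ mul_le_mul_of_nonneg_left h₂ hl.le⟩
  have P₂ : IsCausalPiece (staticMetric h' σ') (slab M t₀ t₁)
      (fun r => (u + 2 * (v - u) + l * u + -l * (γ r).1, (γ r).2)) s₁ s₂ := by
    refine hγ.affine_time hpos hpos' hl hσ hs₁₂ (Icc_subset_Icc hs₁.1 hs₂.2) (Or.inr rfl) ?_
    intro r hr
    have hr' : r ∈ Icc a b := ⟨hs₁.1.trans hr.1, hr.2.trans hs₂.2⟩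
    have h₁ := mul_le_mul_of_nonneg_left (hFm.monotoneOn hs₁ hr' hr.1) hl.le
    have h₂ := mul_le_mul_of_nonneg_left (hFm.monotoneOn hr' hs₂ hr.2) hl.le
    rw [hFs₁] at h₁
    rw [hFs₂] at h₂
    rw [e₂]
    -- The lowest normalized time on the way back is `(3 - l) / 2`; it is nonnegative because `l ≤
    -- 3`. The same bound serves for the third leg.
    exact hconv _ ⟨by linarith, by linarith⟩
  have P₃ : IsCausalPiece (staticMetric h' σ') (slab M t₀ t₁)
      (fun r => (u + (1 - l) * (v - u) - l * u + l * (γ r).1, (γ r).2)) s₂ b := by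
    refine hγ.affine_time hpos hpos' hl hσ hs₂b (Icc_subset_Icc hs₂.1 le_rfl) (Or.inl rfl) ?_
    intro r hr
    have hr' : r ∈ Icc a b := ⟨hs₂.1.trans hr.1, hr.2⟩
    have h₁ := mul_le_mul_of_nonneg_left (hFm.monotoneOn hs₂ hr' hr.1) hl.le
    have h₂ := mul_le_mul_of_nonneg_left (hFm.monotoneOn hr' hb hr.2) hl.le
    rw [hFs₂] at h₁
    rw [hFb] at h₂
    rw [e₃]
    exact hconv _ ⟨by linarith, by linarith⟩
  have Q₁ := nullDist_le_add_of_isCausalPiece P₁ coordTime p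
  have Q₂ := nullDist_le_add_of_isCausalPiece P₂ coordTime p
  have Q₃ := nullDist_le_add_of_isCausalPiece P₃ coordTime p
  simp only [coordTime, e₁, e₂, e₃, hFa, hFs₁, hFs₂, hFb] at Q₁ Q₂ Q₃
  have f₀ : (u + (v - u) * (l * 0), (γ a).2) = γ a := Prod.ext (by simp [hu]) rfl
  have f₁ : u + (v - u) * (2 - l * (1 / l)) = u + (v - u) * (l * (1 / l)) := by
    rw [hli]; ring
  have f₂ : u + (v - u) * (1 - l + l * ((1 + 1 / l) / 2)) =
      u + (v - u) * (2 - l * ((1 + 1 / l) / 2)) := by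
    linear_combination (v - u) * hli
  have f₃ : (u + (v - u) * (1 - l + l * 1), (γ b).2) = γ b :=
    Prod.ext (by simp [hv]) rfl
  rw [f₃, f₂] at Q₃
  rw [f₁] at Q₂
  rw [f₀] at Q₁
  refine Q₃.trans ((add_le_add_left (Q₂.trans (add_le_add_left Q₁ _)) _).trans ?_)
  rw [add_assoc, add_assoc, ← ENNReal.ofReal_add (abs_nonneg _) (abs_nonneg _),
    ← ENNReal.ofReal_add (abs_nonneg _) (by positivity)]
  refine add_le_add_right (ENNReal.ofReal_le_ofReal (le_of_eq ?_)) _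
  -- The normalized lengths of the legs add up to `1 + (l - 1) / 2 + (l - 1) / 2 = l`.
  have g₁ : u + (v - u) * (l * (1 / l)) - (u + (v - u) * (l * 0)) = (v - u) * 1 := by
    rw [hli]; ring
  have g₂ : u + (v - u) * (2 - l * ((1 + 1 / l) / 2)) - (u + (v - u) * (l * (1 / l))) =
      (v - u) * -((l - 1) / 2) := by
    linear_combination -(3 / 2 * (v - u)) * hli
  have g₃ : u + (v - u) * (1 - l + l * 1) - (u + (v - u) * (2 - l * ((1 + 1 / l) / 2))) =
      (v - u) * ((l - 1) / 2) := by
    linear_combination ((v - u) / 2) * hli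
  rw [g₁, g₂, g₃, abs_mul, abs_mul, abs_mul, abs_neg, abs_of_pos (by linarith : 0 < (l - 1) / 2),
    abs_one, coordTime, coordTime, ← hu, ← hv]
  ring

lemma le_add_sum_of_forall_succ_le {k : ℕ} (f : Fin (k + 1) → ℝ≥0∞) (w : Fin k → ℝ≥0∞)
    (hfw : ∀ i : Fin k, f i.succ ≤ f i.castSucc + w i) : f (Fin.last k) ≤ f 0 + ∑ i, w i := by
  induction k with
  | zero => simp
  | succ k ih =>
    rw [Fin.sum_univ_castSucc, ← add_assoc]
    have := ih (fun i => f i.castSucc) (fun i => w i.castSucc) fun i => hfw i.castSucc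
    exact (hfw (Fin.last k)).trans (add_le_add_left this _)

/-- Comparison of null distances: if `σ' / h'²` is at most `l² σ / h²` then the null distance of
the metric `-h'² dt² + σ'` is at most `l` times the null length of the causal curves of
`-h² dt² + σ`. -/
lemma nullDist_le_mul_nullLength (hpos : ∀ x, 0 < h x) (hpos' : ∀ x, 0 < h' x)
    (hl₁ : 1 < l) (hl₃ : l ≤ 3)
    (hσ : ∀ (x : M) (v : TangentSpace I x),
      σ'.inner x v v / h' x ^ 2 ≤ l ^ 2 * (σ.inner x v v / h x ^ 2))
    {p q : ℝ × M} (hp : p ∈ slab M t₀ t₁)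
    (β : PiecewiseCausalCurve (staticMetric h σ) (slab M t₀ t₁) p q) :
    nullDist coordTime (staticMetric h' σ') (slab M t₀ t₁) p q ≤
      ENNReal.ofReal (l * β.nullLength coordTime) := by
  have := le_add_sum_of_forall_succ_le
    (fun i => nullDist coordTime (staticMetric h' σ') (slab M t₀ t₁) p (β.toFun (β.s i))) _
    fun i => nullDist_coordTime_le_add hpos hpos' hl₁ hl₃ hσ (β.isCausalPiece i) p
  simp only [β.source, β.target, nullDist_self coordTime hp, zero_add] at this
  refine this.trans (le_of_eq ?_)
  rw [PiecewiseCausalCurve.nullLength, Finset.mul_sum, ENNReal.ofReal_sum_of_nonneg]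
  intro i _
  have : 0 < l := by linarith
  positivity

end Comparison

/-! ### Finiteness of the null diameter of the slab. -/

section Diameter

variable {E : Type*} [NormedAddCommGroup E] [NormedSpace ℝ E]
  {H : Type*} [TopologicalSpace H] {I : ModelWithCorners ℝ E H}
  {M : Type*} [TopologicalSpace M] [ChartedSpace H M]

attribute [local instance] normedAddCommGroupTangentSpaceVectorSpace
  normedSpaceTangentSpaceVectorSpace in
/-- The derivative of the inverse of a chart is locally bounded for a continuous Riemannian
metric. -/
lemma eventually_inner_mfderivWithin_symm_extChartAt_le [IsManifold I 1 M]
    (σ : ContinuousRiemannianMetric E (fun x : M => TangentSpace I x)) (x : M) :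
    ∃ C > 0, ∀ᶠ y in 𝓝[range I] (extChartAt I x x), ∀ w : E,
      σ.inner ((extChartAt I x).symm y)
        (mfderivWithin 𝓘(ℝ, E) I (extChartAt I x).symm (range I) y w)
        (mfderivWithin 𝓘(ℝ, E) I (extChartAt I x).symm (range I) y w) ≤ (C * ‖w‖) ^ 2 := by
  -- With the norms on the tangent spaces induced by `σ`, a bound on the operator norm becomes a
  -- bound on `σ.inner`.
  let : RiemannianBundle (fun x : M => TangentSpace I x) := ⟨σ.toRiemannianMetric⟩
  obtain ⟨C, hC, h⟩ := eventually_norm_mfderivWithin_symm_extChartAt_lt I x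
  refine ⟨C, hC, h.mono fun y hy w => ?_⟩
  have h₁ := ContinuousLinearMap.le_opNorm
    (mfderivWithin 𝓘(ℝ, E) I (extChartAt I x).symm (range I) y) w
  have h₂ : ‖mfderivWithin 𝓘(ℝ, E) I (extChartAt I x).symm (range I) y w‖ ≤ C * ‖w‖ :=
    h₁.trans (mul_le_mul_of_nonneg_right hy.le (norm_nonneg w))
  have h₃ := pow_le_pow_left₀ (norm_nonneg _) h₂ 2
  rw [← real_inner_self_eq_norm_sq] at h₃
  exact h₃

/-- Nearby points are joined by smooth curves of small speed. -/
lemma eventually_exists_curve_inner_le [IsManifold I ∞ M]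
    (σ : ContinuousRiemannianMetric E (fun x : M => TangentSpace I x)) (x : M)
    {ε : ℝ} (hε : 0 < ε) :
    ∃ U ∈ 𝓝 x, ∀ y ∈ U, ∀ z ∈ U, ∃ c : ℝ → M,
      ContMDiffOn 𝓘(ℝ, ℝ) I ∞ c (Icc 0 1) ∧ c 0 = y ∧ c 1 = z ∧
      ∀ r ∈ Icc (0 : ℝ) 1, σ.inner (c r) (mfderivWithin 𝓘(ℝ, ℝ) I c (Icc 0 1) r 1)
        (mfderivWithin 𝓘(ℝ, ℝ) I c (Icc 0 1) r 1) ≤ ε ^ 2 := by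
  obtain ⟨C, hC, h⟩ := eventually_inner_mfderivWithin_symm_extChartAt_le σ x
  obtain ⟨r₀, hr₀, hr⟩ := Metric.mem_nhdsWithin_iff.1
    (inter_mem (extChartAt_target_mem_nhdsWithin (I := I) x) h)
  -- Two points of a ball of radius `ρ` are less than `2 * ρ` apart, so the segment between them in
  -- the chart has `σ`-speed at most `C * (2 * ρ) ≤ ε`.
  obtain ⟨ρ, hρ, hρr, hρε⟩ : ∃ ρ > 0, ρ ≤ r₀ ∧ C * (2 * ρ) ≤ ε := by
    refine ⟨min r₀ (ε / (2 * C)), by positivity, min_le_left _ _, ?_⟩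
    have := min_le_right r₀ (ε / (2 * C))
    rw [le_div_iff₀ (by positivity)] at this
    linarith
  have hb : Metric.ball (extChartAt I x x) ρ ⊆ Metric.ball (extChartAt I x x) r₀ :=
    Metric.ball_subset_ball hρr
  refine ⟨extChartAt I x ⁻¹' (Metric.ball (extChartAt I x x) ρ ∩ range I) ∩
    (extChartAt I x).source, inter_mem ?_ (extChartAt_source_mem_nhds x), ?_⟩
  · apply extChartAt_preimage_mem_nhds_of_mem_nhdsWithin (by simp)
    rw [inter_comm]
    exact inter_mem_nhdsWithin _ (Metric.ball_mem_nhds _ hρ)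
  rintro y ⟨hy, hys⟩ z ⟨hz, hzs⟩
  set Y := extChartAt I x y with hY
  set Z := extChartAt I x z with hZ
  obtain ⟨η, hη⟩ : ∃ η : ℝ → E, ∀ r, η r = Y + r • (Z - Y) := ⟨_, fun _ => rfl⟩
  have hηe : η = fun r => Y + r • (Z - Y) := funext hη
  have hηm : ∀ r ∈ Icc (0 : ℝ) 1, η r ∈ Metric.ball (extChartAt I x x) ρ ∩ range I := by
    intro r hr
    rw [hη]
    -- Convexity of `range I` keeps the segment inside the model at boundary points too.
    exact ((convex_ball _ _).inter I.convex_range).add_smul_sub_mem hy hz hr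
  have hηt : MapsTo η (Icc 0 1) (extChartAt I x).target := fun r hr' =>
    (hr ⟨hb (hηm r hr').1, (hηm r hr').2⟩).1
  have hηs : ContDiff ℝ ∞ η := by rw [hηe]; fun_prop
  refine ⟨(extChartAt I x).symm ∘ η,
    (contMDiffOn_extChartAt_symm x).comp hηs.contMDiff.contMDiffOn hηt, ?_, ?_, ?_⟩
  · simp only [Function.comp, hη, zero_smul, add_zero]
    exact (extChartAt I x).left_inv hys
  · simp only [Function.comp, hη, one_smul, add_sub_cancel]
    exact (extChartAt I x).left_inv hzs
  intro r hr'
  have h₁ : HasMFDerivWithinAt 𝓘(ℝ, ℝ) 𝓘(ℝ, E) η (Icc 0 1) r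
      (ContinuousLinearMap.toSpanSingleton ℝ (Z - Y)) := by
    have : HasDerivAt η (Z - Y) r := by
      rw [hηe]
      simpa using ((hasDerivAt_id r).smul_const (Z - Y)).const_add Y
    exact this.hasFDerivAt.hasMFDerivAt.hasMFDerivWithinAt
  have h₂ : MDifferentiableWithinAt 𝓘(ℝ, E) I (extChartAt I x).symm (range I) (η r) :=
    mdifferentiableWithinAt_extChartAt_symm (hηt hr')
  have h₃ := (HasMFDerivWithinAt.comp r h₂.hasMFDerivWithinAt h₁
    fun s hs => (hηm s hs).2).mfderivWithin (uniqueMDiffWithinAt_Icc zero_lt_one hr')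
  have h₄ : mfderivWithin 𝓘(ℝ, ℝ) I ((extChartAt I x).symm ∘ η) (Icc 0 1) r 1 =
      mfderivWithin 𝓘(ℝ, E) I (extChartAt I x).symm (range I) (η r) (Z - Y) := by
    rw [h₃]
    exact congrArg (mfderivWithin 𝓘(ℝ, E) I (extChartAt I x).symm (range I) (η r))
      (one_smul ℝ (Z - Y))
  rw [h₄]
  refine ((hr ⟨hb (hηm r hr').1, (hηm r hr').2⟩).2 (Z - Y)).trans ?_
  refine pow_le_pow_left₀ (by positivity) (le_trans ?_ hρε) 2
  refine mul_le_mul_of_nonneg_left ?_ hC.le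
  rw [← dist_eq_norm]
  have := dist_triangle_right Z Y (extChartAt I x x)
  have h₅ := Metric.mem_ball.1 hy.1
  have h₆ := Metric.mem_ball.1 hz.1
  linarith

variable [IsManifold I ∞ M] {h : M → ℝ}
  {σ : ContinuousRiemannianMetric E (fun x : M => TangentSpace I x)} {t₀ t₁ : ℝ}

/-- A curve in `M` together with an affine time coordinate that moves fast enough is causal. -/
lemma isCausalPiece_affine {c : ℝ → M} (hc : ContMDiffOn 𝓘(ℝ, ℝ) I ∞ c (Icc 0 1))
    {s t : ℝ} (hs : s ∈ Icc t₀ t₁) (ht : t ∈ Icc t₀ t₁) (hst : s ≠ t)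
    (hσ : ∀ r ∈ Icc (0 : ℝ) 1, σ.inner (c r) (mfderivWithin 𝓘(ℝ, ℝ) I c (Icc 0 1) r 1)
        (mfderivWithin 𝓘(ℝ, ℝ) I c (Icc 0 1) r 1) ≤ (h (c r) * (t - s)) ^ 2) :
    IsCausalPiece (staticMetric h σ) (slab M t₀ t₁) (fun r => (s + r * (t - s), c r)) 0 1 := by
  have hd : ∀ r ∈ Icc (0 : ℝ) 1, derivWithin (fun r => s + r * (t - s)) (Icc 0 1) r = t - s :=
    fun r hr => by
      have : HasDerivAt (fun r => s + r * (t - s)) (t - s) r := by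
        simpa using ((hasDerivAt_id r).mul_const (t - s)).const_add s
      exact this.hasDerivWithinAt.derivWithin (uniqueDiffOn_Icc zero_lt_one r hr)
  refine ⟨zero_lt_one, fun r hr => ⟨?_, mem_univ _⟩, ContDiff.contDiffOn (by fun_prop), hc, ?_⟩
  · have := (convex_Icc t₀ t₁).add_smul_sub_mem hs ht hr
    exact this
  have hg : ∀ r ∈ Icc (0 : ℝ) 1, staticMetric h σ (s + r * (t - s), c r)
      (velocity I (fun r => (s + r * (t - s), c r)) (Icc 0 1) r)
      (velocity I (fun r => (s + r * (t - s), c r)) (Icc 0 1) r) ≤ 0 := by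
    intro r hr
    simp only [staticMetric, velocity]
    rw [hd r hr]
    linarith [hσ r hr]
  rcases hst.lt_or_gt with hlt | hlt
  · exact Or.inl fun r hr => ⟨hg r hr, (sub_pos.2 hlt).trans_eq (hd r hr).symm⟩
  · exact Or.inr fun r hr => ⟨hg r hr, (hd r hr).trans_lt (sub_neg.2 hlt)⟩

lemma nullDist_le_add_of_curve {c : ℝ → M} (hc : ContMDiffOn 𝓘(ℝ, ℝ) I ∞ c (Icc 0 1))
    {s t : ℝ} (hs : s ∈ Icc t₀ t₁) (ht : t ∈ Icc t₀ t₁) (hst : s ≠ t)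
    (hσ : ∀ r ∈ Icc (0 : ℝ) 1, σ.inner (c r) (mfderivWithin 𝓘(ℝ, ℝ) I c (Icc 0 1) r 1)
        (mfderivWithin 𝓘(ℝ, ℝ) I c (Icc 0 1) r 1) ≤ (h (c r) * (t - s)) ^ 2) (p : ℝ × M) :
    nullDist coordTime (staticMetric h σ) (slab M t₀ t₁) p (t, c 1) ≤
      nullDist coordTime (staticMetric h σ) (slab M t₀ t₁) p (s, c 0) +
        ENNReal.ofReal (t₁ - t₀) := by
  have := nullDist_le_add_of_isCausalPiece (isCausalPiece_affine hc hs ht hst hσ) coordTime p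
  simp only [coordTime, zero_mul, one_mul, add_zero, add_sub_cancel] at this
  refine this.trans (add_le_add_right (ENNReal.ofReal_le_ofReal ?_) _)
  exact abs_le.2 ⟨by linarith [hs.2, ht.1], by linarith [hs.1, ht.2]⟩

/-- A vertical segment is causal in either time direction, since its spatial velocity vanishes. -/
lemma nullDist_le_add_of_snd_eq {s t : ℝ} (hs : s ∈ Icc t₀ t₁) (ht : t ∈ Icc t₀ t₁) (y : M)
    (p : ℝ × M) :
    nullDist coordTime (staticMetric h σ) (slab M t₀ t₁) p (t, y) ≤
      nullDist coordTime (staticMetric h σ) (slab M t₀ t₁) p (s, y) +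
        ENNReal.ofReal (t₁ - t₀) := by
  rcases eq_or_ne s t with rfl | hst
  · exact le_self_add
  refine nullDist_le_add_of_curve (c := fun _ => y) contMDiffOn_const hs ht hst
    (fun r hr => ?_) p
  rw [mfderivWithin_const]
  simpa using sq_nonneg _

/-- The null distance is locally bounded, uniformly in the time coordinates. -/
lemma exists_nhds_nullDist_le_add [CompactSpace M] (ht : t₀ < t₁) (hpos : ∀ x, 0 < h x)
    (hcont : Continuous h) (x : M) :
    ∃ U ∈ 𝓝 x, ∀ y ∈ U, ∀ z ∈ U, ∀ s ∈ Icc t₀ t₁, ∀ t ∈ Icc t₀ t₁, ∀ p : ℝ × M,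
      nullDist coordTime (staticMetric h σ) (slab M t₀ t₁) p (t, z) ≤
        nullDist coordTime (staticMetric h σ) (slab M t₀ t₁) p (s, y) +
          (ENNReal.ofReal (t₁ - t₀) + ENNReal.ofReal (t₁ - t₀) + ENNReal.ofReal (t₁ - t₀)) := by
  -- At the minimum `x₀` of `h`, spatial speed `h x₀ * (t₁ - t₀)` is slow enough for a
  -- unit-parameter curve to be causal anywhere in `M` while time crosses all of `[t₀, t₁]`.
  obtain ⟨x₀, -, hx₀⟩ := isCompact_univ.exists_isMinOn ⟨x, mem_univ x⟩ hcont.continuousOn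
  have hd : 0 < t₁ - t₀ := sub_pos.2 ht
  obtain ⟨U, hU, hc⟩ := eventually_exists_curve_inner_le σ x (mul_pos (hpos x₀) hd)
  refine ⟨U, hU, fun y hy z hz s hs t hts p => ?_⟩
  obtain ⟨c, hcs, rfl, rfl, hcσ⟩ := hc y hy z hz
  have ht₀ : t₀ ∈ Icc t₀ t₁ := left_mem_Icc.2 ht.le
  have ht₁ : t₁ ∈ Icc t₀ t₁ := right_mem_Icc.2 ht.le
  -- The route is vertical to time `t₀`, then across while time runs from `t₀` to `t₁`, then
  -- vertical to time `t`.
  have h₁ := nullDist_le_add_of_snd_eq (h := h) (σ := σ) hs ht₀ (c 0) p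
  have h₃ := nullDist_le_add_of_snd_eq (h := h) (σ := σ) ht₁ hts (c 1) p
  have h₂ := nullDist_le_add_of_curve (h := h) (σ := σ) hcs ht₀ ht₁ ht.ne (fun r hr => ?_) p
  · refine h₃.trans ((add_le_add_left (h₂.trans (add_le_add_left h₁ _)) _).trans (le_of_eq ?_))
    ring
  · refine (hcσ r hr).trans (pow_le_pow_left₀ (mul_pos (hpos x₀) hd).le ?_ 2)
    exact mul_le_mul_of_nonneg_right (hx₀ (mem_univ (c r))) hd.le

/-- The null distance of a static metric on a compact connected slab is bounded. -/
lemma exists_nullDist_le [CompactSpace M] [ConnectedSpace M] (ht : t₀ < t₁)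
    (hpos : ∀ x, 0 < h x) (hcont : Continuous h) :
    ∃ D : ℝ, 0 ≤ D ∧ ∀ p ∈ slab M t₀ t₁, ∀ q ∈ slab M t₀ t₁,
      nullDist coordTime (staticMetric h σ) (slab M t₀ t₁) p q ≤ ENNReal.ofReal D := by
  -- Uniformity in both times and in `p` lets these bounds be composed with added constants.
  let R : M → M → ℝ≥0∞ → Prop := fun y z K =>
    ∀ s ∈ Icc t₀ t₁, ∀ t ∈ Icc t₀ t₁, ∀ p : ℝ × M,
      nullDist coordTime (staticMetric h σ) (slab M t₀ t₁) p (t, z) ≤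
        nullDist coordTime (staticMetric h σ) (slab M t₀ t₁) p (s, y) + K
  have hR : ∀ x y z K K', R x y K → R y z K' → R x z (K + K') := by
    intro x y z K K' h₁ h₂ s hs t hts p
    refine (h₂ s hs t hts p).trans ?_
    rw [← add_assoc]
    exact add_le_add_left (h₁ s hs s hs p) _
  obtain ⟨K₀, hK₀, hloc⟩ : ∃ K₀ : ℝ≥0∞, K₀ ≠ ⊤ ∧ ∀ x : M, ∃ U ∈ 𝓝 x, ∀ y ∈ U, ∀ z ∈ U,
      R y z K₀ :=
    ⟨_, by simp, fun x => exists_nhds_nullDist_le_add ht hpos hcont x⟩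
  -- Connectedness chains the local bounds, with a finite constant that still depends on the pair.
  have hall : ∀ x y : M, ∃ K : ℝ≥0∞, K ≠ ⊤ ∧ R x y K := by
    refine PreconnectedSpace.induction₂' _ (fun x => ?_) ⟨?_⟩
    · obtain ⟨U, hU, h⟩ := hloc x
      filter_upwards [hU] with y hy
      exact ⟨⟨K₀, hK₀, h x (mem_of_mem_nhds hU) y hy⟩, ⟨K₀, hK₀, h y hy x (mem_of_mem_nhds hU)⟩⟩
    · rintro x y z ⟨K, hK, h₁⟩ ⟨K', hK', h₂⟩
      exact ⟨K + K', ENNReal.add_ne_top.2 ⟨hK, hK'⟩, hR x y z K K' h₁ h₂⟩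
  have hunif : ∃ K : ℝ≥0∞, K ≠ ⊤ ∧ ∀ y ∈ (univ : Set M), ∀ z ∈ (univ : Set M), R y z K := by
    obtain ⟨x₀⟩ := (inferInstance : Nonempty M)
    -- Compactness makes the constant uniform in one variable, relative to a base point. Both
    -- directions are recorded, so that any two points can be linked through `x₀`.
    have h₁ : ∃ K : ℝ≥0∞, K ≠ ⊤ ∧ ∀ y ∈ (univ : Set M), R x₀ y K ∧ R y x₀ K := by
      refine isCompact_univ.induction_on (p := fun S => ∃ K : ℝ≥0∞, K ≠ ⊤ ∧
        ∀ y ∈ S, R x₀ y K ∧ R y x₀ K) ⟨0, by simp, by simp⟩ ?_ ?_ ?_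
      · rintro S T hST ⟨K, hK, h⟩
        exact ⟨K, hK, fun y hy => h y (hST hy)⟩
      · rintro S T ⟨K, hK, h⟩ ⟨K', hK', h'⟩
        refine ⟨K + K', ENNReal.add_ne_top.2 ⟨hK, hK'⟩, fun y hy => ?_⟩
        rcases hy with hy | hy
        · exact ⟨fun s hs t ht p => ((h y hy).1 s hs t ht p).trans
              (add_le_add_right le_self_add _),
            fun s hs t ht p => ((h y hy).2 s hs t ht p).trans (add_le_add_right le_self_add _)⟩
        · exact ⟨fun s hs t ht p => ((h' y hy).1 s hs t ht p).trans
              (add_le_add_right le_add_self _),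
            fun s hs t ht p => ((h' y hy).2 s hs t ht p).trans (add_le_add_right le_add_self _)⟩
      · intro x _
        obtain ⟨U, hU, h⟩ := hloc x
        obtain ⟨K, hK, h₁⟩ := hall x₀ x
        obtain ⟨K', hK', h₂⟩ := hall x x₀
        have hx := mem_of_mem_nhds hU
        refine ⟨U, mem_nhdsWithin_of_mem_nhds hU, (K + K₀) + (K₀ + K'), by simp [*],
          fun y hy => ⟨fun s hs t ht p => ?_, fun s hs t ht p => ?_⟩⟩
        · exact (hR _ _ _ _ _ h₁ (h x hx y hy) s hs t ht p).trans
            (add_le_add_right le_self_add _)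
        · exact (hR _ _ _ _ _ (h y hy x hx) h₂ s hs t ht p).trans
            (add_le_add_right le_add_self _)
    obtain ⟨K, hK, h₁⟩ := h₁
    exact ⟨K + K, ENNReal.add_ne_top.2 ⟨hK, hK⟩, fun y hy z hz =>
      hR _ _ _ _ _ (h₁ y hy).2 (h₁ z hz).1⟩
  obtain ⟨K, hK, hu⟩ := hunif
  refine ⟨K.toReal, ENNReal.toReal_nonneg, fun p hp q hq => ?_⟩
  rw [ENNReal.ofReal_toReal hK]
  have := hu p.2 (mem_univ _) q.2 (mem_univ _) p.1 hp.1 q.1 hq.1 p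
  rwa [nullDist_self coordTime hp, zero_add] at this

end Diameter

end StaticSpacetime

/-! ### The theorem: comparison combined with the diameter bound. -/

theorem mainTheorem6
    {E : Type*} [NormedAddCommGroup E] [NormedSpace ℝ E] [FiniteDimensional ℝ E]
    {H : Type*} [TopologicalSpace H] (I : ModelWithCorners ℝ E H)
    {M : Type*} [TopologicalSpace M] [ChartedSpace H M] [IsManifold I ∞ M]
    [T2Space M] [CompactSpace M] [ConnectedSpace M]
    (t₀ t₁ : ℝ) (ht : t₀ < t₁)
    (σ : ℕ → ContinuousRiemannianMetric E (fun x : M => TangentSpace I x))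
    (σinf : ContinuousRiemannianMetric E (fun x : M => TangentSpace I x))
    (h : ℕ → M → ℝ) (hinf : M → ℝ)
    (h_pos : ∀ j x, 0 < h j x) (hinf_pos : ∀ x, 0 < hinf x) (hinf_cont : Continuous hinf)
    (lower_bound : ∀ j : ℕ, 1 ≤ j → ∀ (x : M) (v : TangentSpace I x),
      (1 - 1 / (j : ℝ)) * (σinf.inner x v v / hinf x ^ 2) ≤ (σ j).inner x v v / h j x ^ 2) :
    ∃ C : ℕ → ℝ, (∀ j, 0 ≤ C j) ∧ Tendsto C atTop (𝓝 0) ∧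
      ∀ j : ℕ, 1 ≤ j → ∀ p ∈ StaticSpacetime.slab M t₀ t₁, ∀ q ∈ StaticSpacetime.slab M t₀ t₁,
        StaticSpacetime.nullDist StaticSpacetime.coordTime
            (StaticSpacetime.staticMetric hinf σinf) (StaticSpacetime.slab M t₀ t₁) p q
            - ENNReal.ofReal (C j) ≤
          StaticSpacetime.nullDist StaticSpacetime.coordTime
            (StaticSpacetime.staticMetric (h j) (σ j)) (StaticSpacetime.slab M t₀ t₁) p q := by
  obtain ⟨D, hD, hdiam⟩ := StaticSpacetime.exists_nullDist_le (h := hinf) (σ := σinf) ht hinf_pos hinf_cont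
  have hsqrt : ∀ j : ℕ, Real.sqrt (1 - 1 / (j : ℝ)) ≤ 1 := fun j => by
    refine Real.sqrt_le_iff.2 ⟨zero_le_one, ?_⟩
    have : 0 ≤ 1 / (j : ℝ) := by positivity
    linarith
  refine ⟨fun j => (1 - Real.sqrt (1 - 1 / (j : ℝ))) * D,
    fun j => mul_nonneg (sub_nonneg.2 (hsqrt j)) hD, ?_, ?_⟩
  · have h₁ : Tendsto (fun j : ℕ => 1 - 1 / (j : ℝ)) atTop (𝓝 (1 - 0)) :=
      tendsto_const_nhds.sub tendsto_one_div_atTop_nhds_zero_nat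
    have h₂ := ((tendsto_const_nhds (x := (1 : ℝ))).sub h₁.sqrt).mul_const D
    simpa using h₂
  intro j hj p hp q hq
  have hpq := hdiam p hp q hq
  rw [tsub_le_iff_right]
  -- For `j = 1` the square root vanishes and `C(1) = D`, so the diameter bound alone suffices.
  rcases hj.eq_or_lt with rfl | hj
  · refine hpq.trans ?_
    simp
  have hj' : (2 : ℝ) ≤ j := by exact_mod_cast hj
  set m := Real.sqrt (1 - 1 / (j : ℝ)) with hm
  have hj₁ : 1 / (j : ℝ) ≤ 1 / 2 := one_div_le_one_div_of_le two_pos hj'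
  have hj₀ : 0 < 1 / (j : ℝ) := by positivity
  have hm2 : m ^ 2 = 1 - 1 / (j : ℝ) := Real.sq_sqrt (by linarith)
  have hm0 : 0 < m := Real.sqrt_pos.2 (by linarith)
  have hm1 : m < 1 := by nlinarith
  -- This provides `l = 1 / m ≤ 3`, as the folding requires.
  have hm3 : 1 / 3 ≤ m := Real.le_sqrt_of_sq_le (by linarith)
  refine le_of_le_of_eq ?_ ENNReal.iInf_add.symm
  refine le_iInf fun β => ?_
  have hβ := StaticSpacetime.nullDist_le_mul_nullLength (l := 1 / m) (σ' := σinf) (h_pos j)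
    hinf_pos (by rw [lt_div_iff₀ hm0]; linarith) (by rw [div_le_iff₀ hm0]; linarith)
    (fun x v => by
      have := lower_bound j hj.le x v
      rw [← hm2] at this
      rw [div_pow, one_pow, one_div_mul_eq_div, le_div_iff₀ (by positivity), mul_comm]
      exact this) hp β
  have hl : 0 ≤ β.nullLength StaticSpacetime.coordTime :=
    Finset.sum_nonneg fun _ _ => abs_nonneg _
  rw [← ENNReal.ofReal_add hl (mul_nonneg (by linarith) hD)]
  -- For a curve of length `ℓ ≤ m * D`, the bound `ℓ / m` is at most `D`, hence exceeds `ℓ` by at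
  -- most `(1 - m) * D`. A longer curve satisfies `D ≤ ℓ + (1 - m) * D` outright.
  rcases le_total (β.nullLength StaticSpacetime.coordTime) (m * D) with hle | hle
  · refine hβ.trans (ENNReal.ofReal_le_ofReal ?_)
    have h₁ : 1 / m * β.nullLength StaticSpacetime.coordTime ≤ D := by
      rw [one_div_mul_eq_div, div_le_iff₀ hm0]; linarith
    have h₂ : m * (1 / m * β.nullLength StaticSpacetime.coordTime) =
        β.nullLength StaticSpacetime.coordTime := by field_simp
    nlinarith
  · refine hpq.trans (ENNReal.ofReal_le_ofReal ?_)
    linarith
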